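/- Let $H$ be a separable Hilbert space (real or complex) with scalar product $(\cdot,\cdot)$, and let $A=A^*$ be a self-adjoint operator in $H$ with $(Ah,h)\ge C(h,h)$ for all $h\in D(A)$ and some $C>0$. Suppose that $A$ has a complete orthonormal system of eigenvectors $v_k$, $k\ge 1$, with eigenvalues $0<\lambda_1\le\lambda_2\le\dots$, $\lambda_k\to+\infty$. For $\sigma>0$ put $$A^\sigma g=\sum_{k=1}^\infty\lambda_k^\sigma (g,v_k)v_k,\qquad D(A^\sigma)=\Big\{g\in H:\ \sum_{k=1}^\infty\lambda_k^{2\sigma}|(g,v_k)|^2<\infty\Big\}.$$ Let $0<\rho<1$, $\sigma>0$, $T>0$ and $\varphi\in H$, and consider the forward problem $$D_t^\rho u(t)+A^\sigma u(t)=0,\quad 0<t\le T,\qquad u(0)=\varphi,$$ where $D_t^\rho$ is the Caputo derivative $$D_t^\rho h(t)=\frac{1}{\Gamma(1-\rho)}\frac{d}{dt}\int_0^t\frac{h(\xi)-h(0)}{(t-\xi)^\rho}\,d\xi$$ ($d/dt$ being the left derivative at $t=T$). A solution is a function $u\in C([0,T];H)$ such that $D_t^\rho u(t)$ exists and $u(t)\in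 D(A^\sigma)$ for every $t\in(0,T]$, both $D_t^\rho u$ and $A^\sigma u$ belong to $C((0,T];H)$, and the equation and the initial condition above hold. Then for every $\varphi\in H$ the forward problem has a unique solution, and this solution has the form $$u(t)=\sum_{k=1}^\infty (\varphi,v_k)\,E_\rho(-\lambda_k^\sigma t^\rho)\,v_k,\qquad 0\le t\le T,$$ where the series converges in $H$ and $E_\rho(z)=\sum_{n=0}^\infty \dfrac{z^n}{\Gamma(\rho n+1)}$ is the Mittag-Leffler function. -/

import Mathlib

noncomputable section

open Set

/-- The Mittag-Leffler function `E_ρ(x) = ∑ xⁿ / Γ(ρ n + 1)` (the series converges for every real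
`x` when `ρ > 0`). -/
def mittagLeffler (ρ x : ℝ) : ℝ :=
  ∑' n : ℕ, x ^ n / Real.Gamma (ρ * n + 1)

section Caputo

variable {H : Type*} [NormedAddCommGroup H] [NormedSpace ℝ H]

/-- The integrand `(s - ξ)^(-ρ) (h(ξ) - h(0))` of the Caputo derivative. -/
def caputoKernel (ρ : ℝ) (h : ℝ → H) (s ξ : ℝ) : H :=
  (s - ξ) ^ (-ρ) • (h ξ - h 0)

/-- The function `s ↦ ∫₀ˢ (h(ξ) - h(0)) / (s - ξ)^ρ dξ` (a Bochner integral). -/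
def caputoIntegral (ρ : ℝ) (h : ℝ → H) (s : ℝ) : H :=
  ∫ ξ in (0 : ℝ)..s, caputoKernel ρ h s ξ

/-- The Caputo derivative of order `ρ` of a function on `[0, T]` exists at every point of `(0, T]`:
the integral converges and is differentiable in its upper limit. Differentiation is relative to
`[0, T]`, i.e. two-sided for `0 < t < T` and from the left at `t = T`. -/
def CaputoDifferentiableOn (ρ T : ℝ) (h : ℝ → H) : Prop :=
  ∀ t ∈ Ioc (0 : ℝ) T,
    IntervalIntegrable (caputoKernel ρ h t) MeasureTheory.volume 0 t ∧
      DifferentiableWithinAt ℝ (caputoIntegral ρ h) (Icc 0 T) t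

/-- The Caputo derivative
`D_t^ρ h(t) = (1 / Γ(1 - ρ)) d/dt ∫₀ᵗ (h(ξ) - h(0)) / (t - ξ)^ρ dξ` of a function on `[0, T]`. -/
def caputoDeriv (ρ T : ℝ) (h : ℝ → H) (t : ℝ) : H :=
  (1 / Real.Gamma (1 - ρ)) • derivWithin (caputoIntegral ρ h) (Icc 0 T) t

end Caputo

section Power

variable {𝕜 H : Type*} [RCLike 𝕜] [NormedAddCommGroup H] [InnerProductSpace 𝕜 H]

theorem memlp_iff_summable_weighted (v : HilbertBasis ℕ 𝕜 H) (w : ℕ → ℝ) (g : H) :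
    Memℓp (fun k => (w k : 𝕜) * inner 𝕜 (v k) g) 2 ↔
      Summable fun k => w k ^ 2 * ‖inner 𝕜 (v k) g‖ ^ 2 := by
  rw [memℓp_gen_iff (by norm_num)]
  simp [mul_pow]

theorem summable_weighted (v : HilbertBasis ℕ 𝕜 H) (w : ℕ → ℝ) (g : H)
    (hg : Summable fun k => w k ^ 2 * ‖inner 𝕜 (v k) g‖ ^ 2) :
    Summable fun k => ((w k : 𝕜) * inner 𝕜 (v k) g) • v k :=
  (v.hasSum_repr_symm ⟨_, (memlp_iff_summable_weighted v w g).2 hg⟩).summable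

/-- The power `A^σ g = ∑ λ_k^σ (g, v_k) v_k` of the operator with orthonormal eigenbasis `v_k` and
eigenvalues `λ_k > 0`, with domain `{g | ∑ λ_k^(2σ) |(g, v_k)|² < ∞}`. -/
def spectralPow (v : HilbertBasis ℕ 𝕜 H) (lam : ℕ → ℝ) (σ : ℝ) : H →ₗ.[𝕜] H where
  domain :=
    { carrier := {g | Summable fun k => (lam k ^ σ) ^ 2 * ‖inner 𝕜 (v k) g‖ ^ 2}
      zero_mem' := by simp [summable_zero]
      add_mem' := by
        intro a b ha hb
        have h := ((memlp_iff_summable_weighted v _ a).2 ha).add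
          ((memlp_iff_summable_weighted v _ b).2 hb)
        refine (memlp_iff_summable_weighted v _ (a + b)).1 ?_
        convert h using 1
        funext k
        simp [inner_add_right, mul_add]
      smul_mem' := by
        intro c a ha
        have h := ((memlp_iff_summable_weighted v _ a).2 ha).const_mul c
        refine (memlp_iff_summable_weighted v _ (c • a)).1 ?_
        convert h using 1
        funext k
        simp only [inner_smul_right]
        ring }
  toFun :=
    { toFun := fun g => ∑' k, (((lam k ^ σ : ℝ) : 𝕜) * inner 𝕜 (v k) (g : H)) • v k
      map_add' := by
        intro a b
        rw [← (summable_weighted v _ a.1 a.2).tsum_add (summable_weighted v _ b.1 b.2)]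
        refine tsum_congr fun k => ?_
        simp [inner_add_right, mul_add, add_smul]
      map_smul' := by
        intro c a
        rw [RingHom.id_apply, ← (summable_weighted v _ a.1 a.2).tsum_const_smul c]
        refine tsum_congr fun k => ?_
        simp only [Submodule.coe_smul, inner_smul_right, smul_smul]
        ring_nf }

end Power

/-- `u` is a solution on `[0, T]` of `D_t^ρ u(t) + B u(t) = 0` for `0 < t ≤ T`, `u(0) = φ`, where
`B` is an unbounded operator: `u ∈ C([0, T]; H)`, and `D_t^ρ u` and `B u` exist on `(0, T]` and
belong to `C((0, T]; H)`. Only the values of `u` on `[0, T]` matter. -/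
structure IsForwardSolution {𝕜 H : Type*} [RCLike 𝕜] [NormedAddCommGroup H]
    [InnerProductSpace 𝕜 H] [NormedSpace ℝ H]
    (B : H →ₗ.[𝕜] H) (ρ T : ℝ) (φ : H) (u : ℝ → H) : Prop where
  continuousOn : ContinuousOn u (Icc 0 T)
  caputoDifferentiableOn : CaputoDifferentiableOn ρ T u
  continuousOn_caputoDeriv : ContinuousOn (caputoDeriv ρ T u) (Ioc 0 T)
  mem_domain : ∀ t ∈ Ioc 0 T, u t ∈ B.domain
  continuous_apply :
    Continuous fun t : Ioc (0 : ℝ) T => B ⟨u t, mem_domain t t.2⟩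
  equation : ∀ (t : ℝ) (ht : t ∈ Ioc 0 T),
    caputoDeriv ρ T u t + B ⟨u t, mem_domain t ht⟩ = 0
  initial : u 0 = φ

end

/-!
Expanding in the eigenbasis turns the problem into the scalar relaxation equations
`D^ρ e = -l e`, `e(0) = 1`, with `l = λ_k^σ`, solved by `e(t) = E_ρ(-l t^ρ)`.

*Mittag-Leffler functions.* In the normalization `fracExp ρ c b t = t^b E_{ρ,b+1}(c t^ρ)`, the Beta
integral gives `∫₀ˢ (s - ξ)^p fracExp ρ c b ξ dξ = Γ(p + 1) fracExp ρ c (b + p + 1) s`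
(`integral_rpow_mul_fracExp`). Taking `p = 0`, this is the differentiation rule
`hasDerivAt_fracExp`; taking `p = -ρ`, it gives the relaxation equation, both in the form
`∫₀ᵗ (t - ξ)^(-ρ) e'(ξ) dξ = -l Γ(1 - ρ) e(t)` (`integral_kernel_mul_deriv`) and in the integrated
form `∫₀ˢ (s - ξ)^(-ρ) (e(ξ) - 1) dξ = -l Γ(1 - ρ) ∫₀ˢ e` (`integral_kernel_mul_sub_one`).

*Maximum principle.* If `f` attains its maximum over `[0, t]` at `t`, then
`∫₀ᵗ (t - ξ)^(-ρ) f'(ξ) dξ ≥ t^(-ρ) (f(t) - f(0))` (`rpow_mul_sub_le_integral_of_isMax`). Together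
with the relaxation equation this shows `0 ≤ e ≤ 1` and that `e` decreases in `l`, hence, by scaling,
in `t`. Then `1 - e(t) = (l / Γ(ρ)) ∫₀ᵗ (t - ξ)^(ρ - 1) e(ξ) dξ ≥ l t^ρ e(t) / Γ(ρ + 1)`, which is the
decay bound `l t^ρ e(t) ≤ Γ(ρ + 1)`, uniform in `l` (`mul_rpow_mul_fracExp_le`).

*Existence.* The two bounds make the series `u(t)`, and `V(t) = t^ρ A^σ u(t)`, continuous on `[0, ∞)`.
Coordinatewise, the Caputo integral of `u` is `-Γ(1 - ρ) ∫₀ˢ t^(-ρ) V(t) dt`, where `t^(-ρ)` is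
integrable because `ρ < 1`, and the fundamental theorem of calculus gives the equation.

*Uniqueness.* In real coordinates, the difference `d` of two solutions satisfies
`∫₀ˢ (s - ξ)^(-ρ) d(ξ) dξ = -κ ∫₀ˢ d` with `κ ≥ 0`. For `D(s) = ∫₀ˢ d` this is a relaxation equation
with `D(0) = 0`, so the maximum principle, applied to `D` and `-D`, gives `D = 0` and `d = 0`
(`eqOn_zero_of_integral_eq`).
-/

noncomputable section

open Set MeasureTheory Filter Topology

/-! ### Two-parameter Mittag-Leffler functions -/

/-- A lower bound from the part of Euler's integral over `(M, ∞)`. As `M` is arbitrary, it shows that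
`Γ` grows faster than any exponential. -/
lemma rpow_mul_exp_neg_le_Gamma {x M : ℝ} (hx : 1 ≤ x) (hM : 0 ≤ M) :
    M ^ (x - 1) * Real.exp (-M) ≤ Real.Gamma x := by
  have hint := Real.GammaIntegral_convergent (s := x) (by linarith)
  rw [Real.Gamma_eq_integral (by linarith), ← integral_exp_neg_Ioi, ← integral_const_mul]
  calc ∫ t in Ioi M, M ^ (x - 1) * Real.exp (-t)
      ≤ ∫ t in Ioi M, Real.exp (-t) * t ^ (x - 1) := by
        refine setIntegral_mono_on ((integrableOn_exp_neg_Ioi M).const_mul _)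
          (hint.mono_set (Ioi_subset_Ioi hM)) measurableSet_Ioi fun t ht => ?_
        rw [mul_comm]
        have := mem_Ioi.1 ht
        gcongr
    _ ≤ ∫ t in Ioi (0 : ℝ), Real.exp (-t) * t ^ (x - 1) := by
        refine setIntegral_mono_set hint ?_ (Ioi_subset_Ioi hM).eventuallyLE
        filter_upwards [ae_restrict_mem measurableSet_Ioi] with t ht
        have : 0 < t := ht
        simp only [Pi.zero_apply]
        positivity

lemma summable_pow_div_Gamma {ρ : ℝ} (hρ : 0 < ρ) (β R : ℝ) :
    Summable fun n : ℕ => R ^ n / Real.Gamma (ρ * n + β) := by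
  -- With this `M`, the lower bound for `Γ(ρ n + β)` grows like `(2 |R| + 1)ⁿ`.
  set M : ℝ := (2 * |R| + 1) ^ ρ⁻¹ with hMdef
  have hM : 0 < M := by positivity
  have hMρ : M ^ ρ = 2 * |R| + 1 := by
    rw [hMdef, ← Real.rpow_mul (by positivity), inv_mul_cancel₀ hρ.ne', Real.rpow_one]
  have hr0 : 0 ≤ |R| / (2 * |R| + 1) := by positivity
  have hr1 : |R| / (2 * |R| + 1) < 1 := by
    rw [div_lt_one (by positivity)]
    linarith [abs_nonneg R]
  have hgeo := (summable_geometric_of_lt_one hr0 hr1).mul_left (Real.exp M * M ^ (1 - β))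
  refine hgeo.of_norm_bounded_eventually_nat ?_
  have hlim : Tendsto (fun n : ℕ => ρ * (n : ℝ) + β) atTop atTop :=
    tendsto_atTop_add_const_right _ _ (tendsto_natCast_atTop_atTop.const_mul_atTop hρ)
  filter_upwards [hlim.eventually_ge_atTop 1] with n hn
  have hΓ := rpow_mul_exp_neg_le_Gamma hn hM.le
  have hpos : 0 < M ^ (ρ * n + β - 1) * Real.exp (-M) := by positivity
  have hsplit : M ^ (ρ * n + β - 1) = (2 * |R| + 1) ^ n * (M ^ (1 - β))⁻¹ := by
    rw [← hMρ, ← Real.rpow_natCast, ← Real.rpow_mul hM.le, ← Real.rpow_neg hM.le,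
      ← Real.rpow_add hM]
    ring_nf
  rw [norm_div, norm_pow, Real.norm_eq_abs, Real.norm_of_nonneg (hpos.le.trans hΓ)]
  calc |R| ^ n / Real.Gamma (ρ * n + β) ≤ |R| ^ n / (M ^ (ρ * n + β - 1) * Real.exp (-M)) := by
        gcongr
    _ = Real.exp M * M ^ (1 - β) * (|R| / (2 * |R| + 1)) ^ n := by
        rw [hsplit, Real.exp_neg, div_pow]
        field_simp

/-- The two-parameter Mittag-Leffler function `E_{ρ,β}(x) = ∑ xⁿ / Γ(ρ n + β)`. -/
def mittagLeffler₂ (ρ β x : ℝ) : ℝ :=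
  ∑' n : ℕ, x ^ n / Real.Gamma (ρ * n + β)

lemma mittagLeffler₂_one (ρ x : ℝ) : mittagLeffler₂ ρ 1 x = mittagLeffler ρ x := rfl

lemma continuous_mittagLeffler₂ {ρ : ℝ} (hρ : 0 < ρ) (β : ℝ) :
    Continuous (mittagLeffler₂ ρ β) := by
  have key : ∀ R : ℝ, ContinuousOn (mittagLeffler₂ ρ β) (Metric.ball 0 R) := by
    intro R
    refine continuousOn_tsum (fun n => by fun_prop) (summable_pow_div_Gamma hρ β R).norm ?_
    intro n x hx
    rw [mem_ball_zero_iff] at hx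
    have hxR : ‖x‖ ≤ ‖R‖ := hx.le.trans (le_abs_self R)
    rw [norm_div, norm_div, norm_pow, norm_pow]
    gcongr
  rw [continuous_iff_continuousAt]
  intro x
  refine (key (‖x‖ + 1)).continuousAt (Metric.isOpen_ball.mem_nhds ?_)
  rw [mem_ball_zero_iff]
  linarith

lemma mittagLeffler₂_eq_add {ρ : ℝ} (hρ : 0 < ρ) (β x : ℝ) :
    mittagLeffler₂ ρ β x = 1 / Real.Gamma β + x * mittagLeffler₂ ρ (β + ρ) x := by
  rw [mittagLeffler₂, (summable_pow_div_Gamma hρ β x).tsum_eq_zero_add, mittagLeffler₂,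
    ← tsum_mul_left]
  congr 1
  · simp
  · refine tsum_congr fun n => ?_
    rw [pow_succ', mul_div_assoc]
    push_cast
    ring_nf

/-- The function `t ↦ t ^ b * E_{ρ,b+1}(c t ^ ρ) = ∑ cⁿ t ^ (ρ n + b) / Γ(ρ n + b + 1)`. In this
normalization, integration of order `a` only shifts the index `b` by `a`. -/
def fracExp (ρ c b t : ℝ) : ℝ :=
  t ^ b * mittagLeffler₂ ρ (b + 1) (c * t ^ ρ)

lemma fracExp_zero (ρ c t : ℝ) : fracExp ρ c 0 t = mittagLeffler ρ (c * t ^ ρ) := by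
  simp [fracExp, mittagLeffler₂_one]

lemma fracExp_apply_zero {ρ c b : ℝ} (hb : b ≠ 0) : fracExp ρ c b 0 = 0 := by
  simp [fracExp, Real.zero_rpow hb]

lemma continuousAt_fracExp {ρ : ℝ} (hρ : 0 < ρ) (c b : ℝ) {t : ℝ} (ht : 0 < t) :
    ContinuousAt (fracExp ρ c b) t := by
  refine (Real.continuousAt_rpow_const _ _ (Or.inl ht.ne')).mul ?_
  exact ((continuous_mittagLeffler₂ hρ _).comp
    (continuous_const.mul (Real.continuous_rpow_const hρ.le))).continuousAt

lemma continuous_fracExp {ρ : ℝ} (hρ : 0 < ρ) (c : ℝ) {b : ℝ} (hb : 0 ≤ b) :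
    Continuous (fracExp ρ c b) :=
  (Real.continuous_rpow_const hb).mul ((continuous_mittagLeffler₂ hρ _).comp
    (continuous_const.mul (Real.continuous_rpow_const hρ.le)))

lemma hasSum_fracExp {ρ : ℝ} (hρ : 0 < ρ) (c b : ℝ) {t : ℝ} (ht : 0 < t) :
    HasSum (fun n : ℕ => c ^ n / Real.Gamma (ρ * n + b + 1) * t ^ (ρ * n + b))
      (fracExp ρ c b t) := by
  have h := ((summable_pow_div_Gamma hρ (b + 1) (c * t ^ ρ)).hasSum).mul_left (t ^ b)
  refine h.congr_fun fun n => ?_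
  rw [Real.rpow_add ht, Real.rpow_mul ht.le, Real.rpow_natCast, mul_pow, add_assoc]
  ring

lemma integral_beta {p q s : ℝ} (hp : -1 < p) (hq : -1 < q) (hs : 0 < s) :
    ∫ ξ in (0 : ℝ)..s, (s - ξ) ^ p * ξ ^ q =
      Real.Gamma (p + 1) * Real.Gamma (q + 1) / Real.Gamma (q + p + 2) * s ^ (q + p + 1) := by
  have h1 := Complex.betaIntegral_scaled ((q + 1 : ℝ) : ℂ) ((p + 1 : ℝ) : ℂ) hs
  rw [Complex.betaIntegral_eq_Gamma_mul_div _ _ (by simp; linarith) (by simp; linarith)] at h1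
  apply Complex.ofReal_injective
  rw [← intervalIntegral.integral_ofReal]
  have h2 : ∫ ξ in (0 : ℝ)..s, (((s - ξ) ^ p * ξ ^ q : ℝ) : ℂ) =
      ∫ x in (0 : ℝ)..s, (x : ℂ) ^ (((q + 1 : ℝ) : ℂ) - 1) *
        ((s : ℂ) - x) ^ (((p + 1 : ℝ) : ℂ) - 1) := by
    refine intervalIntegral.integral_congr fun x hx => ?_
    rw [uIcc_of_le hs.le] at hx
    rw [Complex.ofReal_mul, Complex.ofReal_cpow (by linarith [hx.2]), Complex.ofReal_cpow hx.1]
    push_cast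
    simp only [add_sub_cancel_right]
    ring
  rw [h2, h1]
  rw [← Complex.ofReal_add, Complex.Gamma_ofReal, Complex.Gamma_ofReal, Complex.Gamma_ofReal]
  have h3 : ((q + 1 : ℝ) + (p + 1 : ℝ) : ℝ) = q + p + 2 := by ring
  rw [h3]
  have h4 : (((q + p + 2 : ℝ) : ℂ) - 1) = ((q + p + 1 : ℝ) : ℂ) := by push_cast; ring
  rw [h4, ← Complex.ofReal_cpow hs.le]
  push_cast
  ring

/-- A Bochner integral that is not zero is not a junk value, so the closed form `integral_beta` yields
integrability. -/
lemma intervalIntegrable_beta {p q s : ℝ} (hp : -1 < p) (hq : -1 < q) (hs : 0 < s) :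
    IntervalIntegrable (fun ξ => (s - ξ) ^ p * ξ ^ q) volume 0 s := by
  refine intervalIntegral.intervalIntegrable_of_integral_ne_zero ?_
  rw [integral_beta hp hq hs]
  have h1 := Real.Gamma_pos_of_pos (s := p + 1) (by linarith)
  have h2 := Real.Gamma_pos_of_pos (s := q + 1) (by linarith)
  have h3 := Real.Gamma_pos_of_pos (s := q + p + 2) (by linarith)
  positivity

lemma intervalIntegrable_rpow_mul_fracExp {ρ p b s : ℝ} (hρ : 0 < ρ) (c : ℝ) (hp : -1 < p)
    (hb : -1 < b) (hs : 0 < s) :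
    IntervalIntegrable (fun ξ => (s - ξ) ^ p * fracExp ρ c b ξ) volume 0 s := by
  have h := (intervalIntegrable_beta hp hb hs).mul_continuousOn
    (g := fun ξ => mittagLeffler₂ ρ (b + 1) (c * ξ ^ ρ))
    ((continuous_mittagLeffler₂ hρ _).comp
      (continuous_const.mul (Real.continuous_rpow_const hρ.le))).continuousOn
  refine h.congr fun ξ _ => ?_
  simp only [fracExp]
  ring

/-- Fractional integration shifts the index of `fracExp`: the series is integrated term by term with
the Beta integral. -/
lemma integral_rpow_mul_fracExp {ρ p b s : ℝ} (hρ : 0 < ρ) (c : ℝ) (hp : -1 < p) (hb : -1 < b)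
    (hs : 0 < s) :
    ∫ ξ in (0 : ℝ)..s, (s - ξ) ^ p * fracExp ρ c b ξ =
      Real.Gamma (p + 1) * fracExp ρ c (b + p + 1) s := by
  have hq : ∀ n : ℕ, -1 < ρ * n + b := fun n => by
    have : 0 ≤ ρ * n := by positivity
    linarith
  set F : ℕ → ℝ → ℝ := fun n ξ =>
    c ^ n / Real.Gamma (ρ * n + b + 1) * ((s - ξ) ^ p * ξ ^ (ρ * n + b)) with hF
  have hint : ∀ n, IntervalIntegrable (F n) volume 0 s := fun n =>
    (intervalIntegrable_beta hp (hq n) hs).const_mul _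
  -- The coefficient `d` is `c` for the integrals of the terms and `|c|` for those of their norms.
  have hval : ∀ (d : ℝ) (n : ℕ), d ^ n / Real.Gamma (ρ * n + b + 1) *
      (∫ ξ in (0 : ℝ)..s, (s - ξ) ^ p * ξ ^ (ρ * n + b)) = Real.Gamma (p + 1) *
        (d ^ n / Real.Gamma (ρ * n + (b + p + 1) + 1) * s ^ (ρ * n + (b + p + 1))) := by
    intro d n
    have h0 := (Real.Gamma_pos_of_pos (s := ρ * n + b + 1) (by linarith [hq n])).ne'
    rw [integral_beta hp (hq n) hs]
    have e1 : ρ * n + b + p + 2 = ρ * n + (b + p + 1) + 1 := by ring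
    have e2 : ρ * n + b + p + 1 = ρ * n + (b + p + 1) := by ring
    rw [e1, e2]
    field_simp
  have hnorm : ∀ n, ∫ ξ in Ioc 0 s, ‖F n ξ‖ = Real.Gamma (p + 1) *
      (|c| ^ n / Real.Gamma (ρ * n + (b + p + 1) + 1) * s ^ (ρ * n + (b + p + 1))) := by
    intro n
    rw [← hval, ← intervalIntegral.integral_const_mul, intervalIntegral.integral_of_le hs.le]
    refine setIntegral_congr_fun measurableSet_Ioc fun ξ hξ => ?_
    have h0 := (Real.Gamma_pos_of_pos (s := ρ * n + b + 1) (by linarith [hq n])).le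
    have h1 : 0 ≤ (s - ξ) ^ p := Real.rpow_nonneg (by linarith [hξ.2]) _
    have h2 : 0 ≤ ξ ^ (ρ * n + b) := Real.rpow_nonneg hξ.1.le _
    simp only [hF, norm_mul, norm_div, norm_pow, Real.norm_eq_abs, abs_of_nonneg h0,
      abs_of_nonneg h1, abs_of_nonneg h2]
  have hsum := hasSum_integral_of_summable_integral_norm (μ := volume.restrict (Ioc 0 s))
    (F := F) (fun n => (intervalIntegrable_iff_integrableOn_Ioc_of_le hs.le).1 (hint n)) (by
      simp only [hnorm]
      exact (hasSum_fracExp hρ |c| (b + p + 1) hs).summable.mul_left _)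
  have hlhs : ∫ ξ in Ioc 0 s, ∑' n, F n ξ = ∫ ξ in (0 : ℝ)..s, (s - ξ) ^ p * fracExp ρ c b ξ := by
    rw [intervalIntegral.integral_of_le hs.le]
    refine setIntegral_congr_fun measurableSet_Ioc fun ξ hξ => ?_
    rw [← ((hasSum_fracExp hρ c b hξ.1).mul_left ((s - ξ) ^ p)).tsum_eq]
    refine tsum_congr fun n => ?_
    simp only [hF]
    ring
  rw [hlhs] at hsum
  refine hsum.unique ?_
  have hrhs := (hasSum_fracExp hρ c (b + p + 1) hs).mul_left (Real.Gamma (p + 1))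
  have : (fun n => ∫ ξ in Ioc 0 s, F n ξ) = fun n : ℕ => Real.Gamma (p + 1) *
      (c ^ n / Real.Gamma (ρ * n + (b + p + 1) + 1) * s ^ (ρ * n + (b + p + 1))) := by
    funext n
    rw [← hval, ← intervalIntegral.integral_const_mul, intervalIntegral.integral_of_le hs.le]
  rw [this]
  exact hrhs

lemma integral_fracExp {ρ b s : ℝ} (hρ : 0 < ρ) (c : ℝ) (hb : -1 < b) (hs : 0 < s) :
    ∫ ξ in (0 : ℝ)..s, fracExp ρ c b ξ = fracExp ρ c (b + 1) s := by
  have h := integral_rpow_mul_fracExp hρ c (p := 0) (by norm_num) hb hs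
  simpa using h

lemma intervalIntegrable_fracExp {ρ b s : ℝ} (hρ : 0 < ρ) (c : ℝ) (hb : -1 < b) (hs : 0 < s) :
    IntervalIntegrable (fracExp ρ c b) volume 0 s := by
  have h := intervalIntegrable_rpow_mul_fracExp hρ c (p := 0) (by norm_num) hb hs
  simpa using h

/-- Differentiation lowers the index by one; this follows from `integral_fracExp` and the fundamental
theorem of calculus, which avoids differentiating the series. -/
lemma hasDerivAt_fracExp {ρ b t : ℝ} (hρ : 0 < ρ) (c : ℝ) (hb : -1 < b) (ht : 0 < t) :
    HasDerivAt (fracExp ρ c (b + 1)) (fracExp ρ c b t) t := by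
  have hcont : ContinuousOn (fracExp ρ c b) (Ioi 0) := fun x hx =>
    (continuousAt_fracExp hρ c b hx).continuousWithinAt
  have h := intervalIntegral.integral_hasDerivAt_right (intervalIntegrable_fracExp hρ c hb ht)
    (hcont.stronglyMeasurableAtFilter isOpen_Ioi t ht) (continuousAt_fracExp hρ c b ht)
  refine h.congr_of_eventuallyEq ?_
  filter_upwards [Ioi_mem_nhds ht] with s hs
  exact (integral_fracExp hρ c hb hs).symm

lemma fracExp_zero_eq_one_add {ρ c : ℝ} (hρ : 0 < ρ) (t : ℝ) :
    fracExp ρ c 0 t = 1 + c * fracExp ρ c ρ t := by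
  simp only [fracExp, Real.rpow_zero, one_mul, zero_add]
  rw [mittagLeffler₂_eq_add hρ, Real.Gamma_one, add_comm 1 ρ]
  ring

/-! ### The maximum principle for fractional derivatives -/

lemma intervalIntegrable_const_sub_rpow {p s : ℝ} (hp : -1 < p) (hs : 0 < s) :
    IntervalIntegrable (fun ξ => (s - ξ) ^ p) volume 0 s := by
  simpa using intervalIntegrable_beta (q := 0) hp (by norm_num) hs

lemma integral_const_sub_rpow {p s : ℝ} (hp : -1 < p) :
    ∫ ξ in (0 : ℝ)..s, (s - ξ) ^ p = s ^ (p + 1) / (p + 1) := by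
  rw [intervalIntegral.integral_comp_sub_left (fun x => x ^ p), integral_rpow (Or.inl hp)]
  simp [Real.zero_rpow (show p + 1 ≠ 0 by linarith)]

/-- Extremum principle for the Caputo derivative `∫₀ᵗ (t - ξ)^(-ρ) f'(ξ) dξ` at a maximum point `t`
of `f` over `[0, t]`. Formally one integrates by parts, and the remaining integral
`-ρ ∫ (t - ξ)^(-ρ-1) (f(ξ) - f(t)) dξ` is nonnegative. -/
lemma rpow_mul_sub_le_integral_of_isMax {ρ t : ℝ} {f f' : ℝ → ℝ} (hρ : ρ ∈ Ioo (0 : ℝ) 1)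
    (ht : 0 < t) (hc : ContinuousOn f (Icc 0 t))
    (hd : ∀ x ∈ Ioc 0 t, HasDerivWithinAt f (f' x) (Icc 0 t) x)
    (hint : IntervalIntegrable (fun ξ => (t - ξ) ^ (-ρ) * f' ξ) volume 0 t)
    (hmax : ∀ x ∈ Icc 0 t, f x ≤ f t) :
    t ^ (-ρ) * (f t - f 0) ≤ ∫ ξ in (0 : ℝ)..t, (t - ξ) ^ (-ρ) * f' ξ := by
  set F : ℝ → ℝ := fun ξ => (t - ξ) ^ (-ρ) * (f ξ - f t) with hF
  -- At `t`, the factor `f ξ - f t = O(t - ξ)` compensates the singularity, as `ρ < 1`; the junk value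
  -- `0 ^ (-ρ)` is multiplied by `0`.
  have hFc : ContinuousOn F (Icc 0 t) := by
    intro x hx
    rcases hx.2.lt_or_eq with hxt | rfl
    · refine ContinuousWithinAt.mul ?_ ((hc x hx).sub continuousWithinAt_const)
      refine ContinuousAt.continuousWithinAt ?_
      exact (continuousAt_const.sub continuousAt_id).rpow_const (Or.inl (by simp; linarith))
    · have hO : (fun ξ => f ξ - f x) =O[𝓝[Icc 0 x] x] fun ξ => ξ - x :=
        (hd x ⟨ht, le_rfl⟩).isBigO_sub.comp_tendsto (tendsto_id.prodMk tendsto_const_pure)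
      have hb : F =O[𝓝[Icc 0 x] x] fun ξ => (x - ξ) ^ (1 - ρ) := by
        refine ((Asymptotics.isBigO_refl (fun ξ => (x - ξ) ^ (-ρ)) _).mul hO).congr' (by rfl) ?_
          |>.trans (Asymptotics.isBigO_refl (fun ξ => -(x - ξ) ^ (1 - ρ)) _)
          |>.trans (Asymptotics.isBigO_refl (fun ξ => (x - ξ) ^ (1 - ρ)) _).neg_left
        filter_upwards [self_mem_nhdsWithin] with ξ hξ
        rcases hξ.2.lt_or_eq with h | rfl
        · rw [show (1 - ρ) = -ρ + 1 by ring, Real.rpow_add_one (by linarith)]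
          ring
        · simp [Real.zero_rpow (show 1 - ρ ≠ 0 by linarith [hρ.2])]
      have hlim : Tendsto (fun ξ => (x - ξ) ^ (1 - ρ)) (𝓝[Icc 0 x] x) (𝓝 0) := by
        have : Continuous fun ξ : ℝ => (x - ξ) ^ (1 - ρ) :=
          (continuous_const.sub continuous_id).rpow_const fun _ => Or.inr (by linarith [hρ.2])
        have h := (this.tendsto x).mono_left (nhdsWithin_le_nhds (s := Icc 0 x))
        simpa [Real.zero_rpow (show 1 - ρ ≠ 0 by linarith [hρ.2])] using h
      have hFx : F x = 0 := by simp [hF]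
      rw [ContinuousWithinAt, hFx]
      exact hb.trans_tendsto hlim
  -- `F' ≤ (t - ξ) ^ (-ρ) * f'`, since the other term of `F'` is nonpositive.
  have key := intervalIntegral.sub_le_integral_of_hasDeriv_right_of_le ht.le hFc
    (g' := fun x => -1 * -ρ * (t - x) ^ (-ρ - 1) * (f x - f t) + (t - x) ^ (-ρ) * f' x)
    (φ := fun ξ => (t - ξ) ^ (-ρ) * f' ξ) ?_
    ((intervalIntegrable_iff_integrableOn_Icc_of_le ht.le).1 hint) ?_
  · have : F t - F 0 = t ^ (-ρ) * (f t - f 0) := by simp [hF]; ring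
    rwa [this] at key
  · intro x hx
    have hfd : HasDerivAt f (f' x) x :=
      (hd x ⟨hx.1, hx.2.le⟩).hasDerivAt (Icc_mem_nhds hx.1 hx.2)
    have hk : HasDerivAt (fun ξ => (t - ξ) ^ (-ρ)) (-1 * -ρ * (t - x) ^ (-ρ - 1)) x :=
      ((hasDerivAt_id x).const_sub t).rpow_const (Or.inl (by simp; linarith [hx.2]))
    exact (hk.mul (hfd.sub_const (f t))).hasDerivWithinAt
  · intro x hx
    have h1 : 0 ≤ (t - x) ^ (-ρ - 1) := Real.rpow_nonneg (by linarith [hx.2]) _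
    have h2 : f x - f t ≤ 0 := by linarith [hmax x ⟨hx.1.le, hx.2.le⟩]
    have h3 := mul_nonpos_of_nonneg_of_nonpos (mul_nonneg hρ.1.le h1) h2
    linarith

/-- Maximum principle: a function that starts nonpositive and whose Caputo derivative (up to the
factor `Γ(1 - ρ)`) is nonpositive wherever the function is positive stays nonpositive. -/
lemma nonpos_of_fractional_le {ρ T : ℝ} {f f' : ℝ → ℝ} (hρ : ρ ∈ Ioo (0 : ℝ) 1)
    (hc : ContinuousOn f (Icc 0 T))
    (hd : ∀ x ∈ Ioc 0 T, HasDerivWithinAt f (f' x) (Icc 0 T) x)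
    (hint : ∀ t ∈ Ioc 0 T, IntervalIntegrable (fun ξ => (t - ξ) ^ (-ρ) * f' ξ) volume 0 t)
    (h0 : f 0 ≤ 0)
    (hle : ∀ t ∈ Ioc 0 T, 0 < f t → ∫ ξ in (0 : ℝ)..t, (t - ξ) ^ (-ρ) * f' ξ ≤ 0) :
    ∀ t ∈ Icc 0 T, f t ≤ 0 := by
  intro t ht
  obtain ⟨m, hm, hmax⟩ := isCompact_Icc.exists_isMaxOn ⟨t, ht⟩ hc
  refine (hmax ht).trans ?_
  by_contra! hpos
  have hm0 : 0 < m := hm.1.lt_of_ne (by rintro rfl; linarith)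
  have hsub : Icc 0 m ⊆ Icc 0 T := Icc_subset_Icc_right hm.2
  have h1 := rpow_mul_sub_le_integral_of_isMax hρ hm0 (hc.mono hsub)
    (fun x hx => (hd x ⟨hx.1, hx.2.trans hm.2⟩).mono hsub) (hint m ⟨hm0, hm.2⟩)
    fun x hx => hmax (hsub hx)
  have h2 := hle m ⟨hm0, hm.2⟩ hpos
  have h3 : 0 < m ^ (-ρ) * (f m - f 0) :=
    mul_pos (Real.rpow_pos_of_pos hm0 _) (by linarith)
  linarith

lemma hasDerivWithinAt_integral_Icc {d : ℝ → ℝ} {T t : ℝ} (hd : ContinuousOn d (Icc 0 T))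
    (ht : t ∈ Icc 0 T) :
    HasDerivWithinAt (fun s => ∫ ξ in (0 : ℝ)..s, d ξ) (d t) (Icc 0 T) t := by
  have : Fact (t ∈ Icc 0 T) := ⟨ht⟩
  refine intervalIntegral.integral_hasDerivWithinAt_right ?_
    (hd.stronglyMeasurableAtFilter_nhdsWithin measurableSet_Icc t) (hd t ht)
  exact (hd.mono (by rw [uIcc_of_le ht.1]; exact Icc_subset_Icc_right ht.2)).intervalIntegrable

/-- Uniqueness for the scalar relaxation equation in integrated form: the primitive of `d` has Caputo
derivative `-κ` times itself, so it vanishes by the maximum principle. -/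
lemma eqOn_zero_of_integral_eq {ρ T κ : ℝ} {d : ℝ → ℝ} (hρ : ρ ∈ Ioo (0 : ℝ) 1) (hT : 0 < T)
    (hκ : 0 ≤ κ) (hd : ContinuousOn d (Icc 0 T))
    (h : ∀ s ∈ Ioc 0 T, ∫ ξ in (0 : ℝ)..s, (s - ξ) ^ (-ρ) * d ξ = -κ * ∫ ξ in (0 : ℝ)..s, d ξ) :
    ∀ t ∈ Icc 0 T, d t = 0 := by
  have aux : ∀ d : ℝ → ℝ, ContinuousOn d (Icc 0 T) →
      (∀ s ∈ Ioc 0 T, ∫ ξ in (0 : ℝ)..s, (s - ξ) ^ (-ρ) * d ξ = -κ * ∫ ξ in (0 : ℝ)..s, d ξ) →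
      ∀ t ∈ Icc 0 T, ∫ ξ in (0 : ℝ)..t, d ξ ≤ 0 := by
    intro d hd h
    refine nonpos_of_fractional_le hρ
      (fun x hx => (hasDerivWithinAt_integral_Icc hd hx).continuousWithinAt)
      (fun x hx => hasDerivWithinAt_integral_Icc hd ⟨hx.1.le, hx.2⟩) ?_ (by simp) ?_
    · intro t ht
      refine (intervalIntegrable_const_sub_rpow (by linarith [hρ.2]) ht.1).mul_continuousOn ?_
      exact hd.mono (by rw [uIcc_of_le ht.1.le]; exact Icc_subset_Icc_right ht.2)
    · intro t ht hpos
      rw [h t ht]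
      nlinarith
  have hD : ∀ t ∈ Icc 0 T, ∫ ξ in (0 : ℝ)..t, d ξ = 0 := by
    intro t ht
    have h1 := aux d hd h t ht
    have h2 := aux (fun ξ => -d ξ) hd.neg (fun s hs => by simp [h s hs]) t ht
    rw [intervalIntegral.integral_neg] at h2
    linarith
  intro t ht
  have h1 := hasDerivWithinAt_integral_Icc hd ht
  have h2 : HasDerivWithinAt (fun s => ∫ ξ in (0 : ℝ)..s, d ξ) 0 (Icc 0 T) t :=
    (hasDerivWithinAt_const t (Icc 0 T) (0 : ℝ)).congr hD (hD t ht)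
  exact (uniqueDiffOn_Icc hT t ht).eq_deriv _ h1 h2

/-! ### Bounds for the relaxation function `E_ρ(-l t^ρ)` -/

lemma fracExp_zero_apply_zero {ρ : ℝ} (hρ : 0 < ρ) (c : ℝ) : fracExp ρ c 0 0 = 1 := by
  rw [fracExp_zero_eq_one_add hρ, fracExp_apply_zero hρ.ne', mul_zero, add_zero]

lemma hasDerivAt_fracExp_zero {ρ : ℝ} (hρ : 0 < ρ) (c : ℝ) {t : ℝ} (ht : 0 < t) :
    HasDerivAt (fracExp ρ c 0) (c * fracExp ρ c (ρ - 1) t) t := by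
  have h := hasDerivAt_fracExp hρ c (b := ρ - 1) (by linarith) ht
  rw [sub_add_cancel] at h
  refine ((h.const_mul c).const_add 1).congr_of_eventuallyEq ?_
  exact Eventually.of_forall fun s => fracExp_zero_eq_one_add hρ s

/-- The equation `D^ρ e = c e` for `e(t) = E_ρ(c t^ρ)`, with the Caputo derivative written as a
fractional integral of `e' = c * fracExp ρ c (ρ - 1)`. -/
lemma integral_kernel_mul_deriv {ρ : ℝ} (hρ : ρ ∈ Ioo (0 : ℝ) 1) (c : ℝ) {t : ℝ} (ht : 0 < t) :
    IntervalIntegrable (fun ξ => (t - ξ) ^ (-ρ) * (c * fracExp ρ c (ρ - 1) ξ)) volume 0 t ∧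
    ∫ ξ in (0 : ℝ)..t, (t - ξ) ^ (-ρ) * (c * fracExp ρ c (ρ - 1) ξ) =
      c * Real.Gamma (1 - ρ) * fracExp ρ c 0 t := by
  have hp : -1 < -ρ := by linarith [hρ.2]
  have hb : -1 < ρ - 1 := by linarith [hρ.1]
  have e : ∀ ξ, (t - ξ) ^ (-ρ) * (c * fracExp ρ c (ρ - 1) ξ) =
      c * ((t - ξ) ^ (-ρ) * fracExp ρ c (ρ - 1) ξ) := fun ξ => by ring
  simp only [e]
  refine ⟨(intervalIntegrable_rpow_mul_fracExp hρ.1 c hp hb ht).const_mul c, ?_⟩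
  rw [intervalIntegral.integral_const_mul, integral_rpow_mul_fracExp hρ.1 c hp hb ht]
  have e1 : ρ - 1 + -ρ + 1 = 0 := by ring
  have e2 : -ρ + 1 = 1 - ρ := by ring
  rw [e1, e2]
  ring

lemma Gamma_one_sub_pos {ρ : ℝ} (hρ : ρ ∈ Ioo (0 : ℝ) 1) : 0 < Real.Gamma (1 - ρ) :=
  Real.Gamma_pos_of_pos (by linarith [hρ.2])

lemma fracExp_nonneg {ρ l t : ℝ} (hρ : ρ ∈ Ioo (0 : ℝ) 1) (hl : 0 ≤ l) (ht : 0 ≤ t) :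
    0 ≤ fracExp ρ (-l) 0 t := by
  have h := nonpos_of_fractional_le hρ (T := t) (f := fun s => -fracExp ρ (-l) 0 s)
    (f' := fun s => -(-l * fracExp ρ (-l) (ρ - 1) s))
    (continuous_fracExp hρ.1 (-l) le_rfl).neg.continuousOn
    (fun x hx => (hasDerivAt_fracExp_zero hρ.1 (-l) hx.1).neg.hasDerivWithinAt)
    (fun s hs => by
      simp only [mul_neg _ (-l * _)]
      exact (integral_kernel_mul_deriv hρ (-l) hs.1).1.neg)
    (by rw [fracExp_zero_apply_zero hρ.1]; norm_num)
    (fun s hs hpos => by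
      have h1 := (integral_kernel_mul_deriv hρ (-l) hs.1).2
      have h2 := mul_nonneg hl (Gamma_one_sub_pos hρ).le
      simp only [mul_neg _ (-l * _), intervalIntegral.integral_neg]
      rw [h1]
      nlinarith) t ⟨ht, le_rfl⟩
  linarith

/-- Monotonicity in the rate. The difference of the two relaxation functions has Caputo derivative
proportional to `l e_l - m e_m`, which is nonpositive wherever `e_m > e_l`. -/
lemma fracExp_le_fracExp {ρ l m t : ℝ} (hρ : ρ ∈ Ioo (0 : ℝ) 1) (hl : 0 ≤ l) (hlm : l ≤ m)
    (ht : 0 ≤ t) : fracExp ρ (-m) 0 t ≤ fracExp ρ (-l) 0 t := by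
  have h := nonpos_of_fractional_le hρ (T := t)
    (f := fun s => fracExp ρ (-m) 0 s - fracExp ρ (-l) 0 s)
    (f' := fun s => -m * fracExp ρ (-m) (ρ - 1) s - -l * fracExp ρ (-l) (ρ - 1) s)
    ((continuous_fracExp hρ.1 (-m) le_rfl).sub
      (continuous_fracExp hρ.1 (-l) le_rfl)).continuousOn
    (fun x hx => ((hasDerivAt_fracExp_zero hρ.1 (-m) hx.1).sub
      (hasDerivAt_fracExp_zero hρ.1 (-l) hx.1)).hasDerivWithinAt)
    (fun s hs => by
      simpa only [mul_sub] using (integral_kernel_mul_deriv hρ (-m) hs.1).1.sub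
        (integral_kernel_mul_deriv hρ (-l) hs.1).1)
    (by rw [fracExp_zero_apply_zero hρ.1, fracExp_zero_apply_zero hρ.1, sub_self])
    (fun s hs hpos => by
      have h1 := integral_kernel_mul_deriv hρ (-m) hs.1
      have h2 := integral_kernel_mul_deriv hρ (-l) hs.1
      have h3 := fracExp_nonneg hρ hl hs.1.le
      have h4 : l * fracExp ρ (-l) 0 s ≤ m * fracExp ρ (-m) 0 s :=
        mul_le_mul hlm (by linarith) h3 (hl.trans hlm)
      have h5 := mul_le_mul_of_nonneg_left h4 (Gamma_one_sub_pos hρ).le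
      simp only [mul_sub]
      rw [intervalIntegral.integral_sub h1.1 h2.1, h1.2, h2.2]
      linarith) t ⟨ht, le_rfl⟩
  linarith

lemma fracExp_le_one {ρ l t : ℝ} (hρ : ρ ∈ Ioo (0 : ℝ) 1) (hl : 0 ≤ l) (ht : 0 ≤ t) :
    fracExp ρ (-l) 0 t ≤ 1 := by
  refine (fracExp_le_fracExp hρ le_rfl hl ht).trans ?_
  rw [fracExp_zero_eq_one_add hρ.1]
  simp

lemma fracExp_antitoneOn {ρ l : ℝ} (hρ : ρ ∈ Ioo (0 : ℝ) 1) (hl : 0 ≤ l) :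
    AntitoneOn (fracExp ρ (-l) 0) (Ici 0) := by
  intro s hs t ht hst
  have hs0 : (0 : ℝ) ≤ s := hs
  -- By scaling, the value at time `x` with rate `l` is the value at time `1` with rate `l * x ^ ρ`.
  have e : ∀ x, fracExp ρ (-l) 0 x = fracExp ρ (-(l * x ^ ρ)) 0 1 := fun x => by
    simp [fracExp_zero]
  rw [e, e]
  refine fracExp_le_fracExp hρ (by positivity) ?_ zero_le_one
  gcongr
  exact hρ.1.le

/-- Decay of the relaxation function, uniformly in the rate: the identity
`Γ(ρ) (1 - e(t)) = l ∫₀ᵗ (t - ξ)^(ρ - 1) e(ξ) dξ` is combined with `e(ξ) ≥ e(t)`. -/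
lemma mul_rpow_mul_fracExp_le {ρ l t : ℝ} (hρ : ρ ∈ Ioo (0 : ℝ) 1) (hl : 0 ≤ l) (ht : 0 ≤ t) :
    l * t ^ ρ * fracExp ρ (-l) 0 t ≤ Real.Gamma (ρ + 1) := by
  have hΓ := Real.Gamma_pos_of_pos hρ.1
  have hΓ1 : Real.Gamma (ρ + 1) = ρ * Real.Gamma ρ := Real.Gamma_add_one hρ.1.ne'
  rcases ht.eq_or_lt with rfl | ht'
  · rw [Real.zero_rpow hρ.1.ne', hΓ1]
    simpa using (mul_pos hρ.1 hΓ).le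
  have hp : -1 < ρ - 1 := by linarith [hρ.1]
  have h1 := integral_rpow_mul_fracExp hρ.1 (-l) hp (b := 0) (by norm_num) ht'
  simp only [sub_add_cancel, zero_add] at h1
  have hmono : ∫ ξ in (0 : ℝ)..t, (t - ξ) ^ (ρ - 1) * fracExp ρ (-l) 0 t ≤
      ∫ ξ in (0 : ℝ)..t, (t - ξ) ^ (ρ - 1) * fracExp ρ (-l) 0 ξ := by
    refine intervalIntegral.integral_mono_on ht
      ((intervalIntegrable_const_sub_rpow hp ht').mul_const _)
      (intervalIntegrable_rpow_mul_fracExp hρ.1 _ hp (by norm_num) ht') fun ξ hξ => ?_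
    refine mul_le_mul_of_nonneg_left (fracExp_antitoneOn hρ hl hξ.1 ht hξ.2)
      (Real.rpow_nonneg (by linarith [hξ.2]) _)
  rw [intervalIntegral.integral_mul_const, integral_const_sub_rpow hp, h1,
    sub_add_cancel] at hmono
  have h2 := fracExp_zero_eq_one_add (c := -l) hρ.1 t
  have h3 := fracExp_nonneg hρ hl ht
  have h4 : l * fracExp ρ (-l) ρ t ≤ 1 := by linarith
  calc l * t ^ ρ * fracExp ρ (-l) 0 t
      = ρ * (l * (t ^ ρ / ρ * fracExp ρ (-l) 0 t)) := by field_simp [hρ.1.ne']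
    _ ≤ ρ * (l * (Real.Gamma ρ * fracExp ρ (-l) ρ t)) := by
        have := hρ.1.le
        gcongr
    _ = ρ * Real.Gamma ρ * (l * fracExp ρ (-l) ρ t) := by ring
    _ ≤ ρ * Real.Gamma ρ * 1 := mul_le_mul_of_nonneg_left h4 (mul_pos hρ.1 hΓ).le
    _ = Real.Gamma (ρ + 1) := by rw [hΓ1, mul_one]

/-- The integrated Caputo equation for the relaxation function. -/
lemma integral_kernel_mul_sub_one {ρ : ℝ} (hρ : ρ ∈ Ioo (0 : ℝ) 1) (c : ℝ) {s : ℝ} (hs : 0 < s) :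
    ∫ ξ in (0 : ℝ)..s, (s - ξ) ^ (-ρ) * (fracExp ρ c 0 ξ - 1) =
      c * Real.Gamma (1 - ρ) * ∫ ξ in (0 : ℝ)..s, fracExp ρ c 0 ξ := by
  have e : ∀ ξ, (s - ξ) ^ (-ρ) * (fracExp ρ c 0 ξ - 1) =
      c * ((s - ξ) ^ (-ρ) * fracExp ρ c ρ ξ) := fun ξ => by
    rw [fracExp_zero_eq_one_add hρ.1]
    ring
  simp only [e]
  rw [intervalIntegral.integral_const_mul, integral_fracExp hρ.1 c (by norm_num) hs,
    integral_rpow_mul_fracExp hρ.1 c (by linarith [hρ.2]) (by linarith [hρ.1]) hs]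
  have e1 : ρ + -ρ + 1 = 0 + 1 := by ring
  have e2 : -ρ + 1 = 1 - ρ := by ring
  rw [e1, e2]
  ring

lemma abs_fracExp_le {ρ l t : ℝ} (hρ : ρ ∈ Ioo (0 : ℝ) 1) (hl : 0 ≤ l) (ht : 0 ≤ t) :
    |fracExp ρ (-l) 0 t| ≤ 1 := by
  rw [abs_of_nonneg (fracExp_nonneg hρ hl ht)]
  exact fracExp_le_one hρ hl ht

lemma abs_mul_rpow_mul_fracExp_le {ρ l t : ℝ} (hρ : ρ ∈ Ioo (0 : ℝ) 1) (hl : 0 ≤ l) (ht : 0 ≤ t) :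
    |l * t ^ ρ * fracExp ρ (-l) 0 t| ≤ Real.Gamma (ρ + 1) := by
  have h := fracExp_nonneg hρ hl ht
  rw [abs_of_nonneg (by positivity)]
  exact mul_rpow_mul_fracExp_le hρ hl ht

lemma rpow_neg_mul_rpow_mul {t : ℝ} (ht : 0 < t) (ρ l e : ℝ) :
    t ^ (-ρ) * (l * t ^ ρ * e) = l * e := by
  have h : t ^ (-ρ) * t ^ ρ = 1 := by rw [← Real.rpow_add ht, neg_add_cancel, Real.rpow_zero]
  linear_combination l * e * h

/-! ### Spectral multipliers -/

section Multiplier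

variable {𝕜 H : Type*} [RCLike 𝕜] [NormedAddCommGroup H] [InnerProductSpace 𝕜 H]

/-- The vector `∑ m_k (g, v_k) v_k`, i.e. the multiplier `m` applied to `g` in the orthonormal
basis `v`; it is meaningful when `∑ m_k² |(g, v_k)|² < ∞`, in particular for bounded `m`. -/
def spectralSum (v : HilbertBasis ℕ 𝕜 H) (m : ℕ → ℝ) (g : H) : H :=
  ∑' k, ((m k : 𝕜) * inner 𝕜 (v k) g) • v k

lemma spectralPow_apply (v : HilbertBasis ℕ 𝕜 H) (lam : ℕ → ℝ) (σ : ℝ)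
    (x : (spectralPow v lam σ).domain) :
    spectralPow v lam σ x = spectralSum v (fun k => lam k ^ σ) (x : H) := rfl

lemma mem_spectralPow_domain {v : HilbertBasis ℕ 𝕜 H} {lam : ℕ → ℝ} {σ : ℝ} {g : H} :
    g ∈ (spectralPow v lam σ).domain ↔
      Summable fun k => (lam k ^ σ) ^ 2 * ‖inner 𝕜 (v k) g‖ ^ 2 := Iff.rfl

lemma summable_weighted_of_abs_le (v : HilbertBasis ℕ 𝕜 H) {m : ℕ → ℝ} {M : ℝ} (hm : ∀ k, |m k| ≤ M)
    (g : H) : Summable fun k => m k ^ 2 * ‖inner 𝕜 (v k) g‖ ^ 2 := by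
  refine ((v.orthonormal.inner_products_summable g).mul_left (M ^ 2)).of_nonneg_of_le
    (fun k => by positivity) fun k => ?_
  have : m k ^ 2 ≤ M ^ 2 := sq_le_sq.2 ((hm k).trans (le_abs_self M))
  gcongr

lemma hasSum_spectralSum (v : HilbertBasis ℕ 𝕜 H) {m : ℕ → ℝ} {g : H}
    (h : Summable fun k => m k ^ 2 * ‖inner 𝕜 (v k) g‖ ^ 2) :
    HasSum (fun k => ((m k : 𝕜) * inner 𝕜 (v k) g) • v k) (spectralSum v m g) :=
  (summable_weighted v m g h).hasSum

lemma inner_spectralSum (v : HilbertBasis ℕ 𝕜 H) {m : ℕ → ℝ} {g : H}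
    (h : Summable fun k => m k ^ 2 * ‖inner 𝕜 (v k) g‖ ^ 2) (k : ℕ) :
    inner 𝕜 (v k) (spectralSum v m g) = (m k : 𝕜) * inner 𝕜 (v k) g := by
  have h1 := (v.hasSum_repr_symm ⟨_, (memlp_iff_summable_weighted v m g).2 h⟩).unique
    (hasSum_spectralSum v h)
  rw [← h1, ← v.repr_apply_apply, LinearIsometryEquiv.apply_symm_apply]

lemma hasSum_norm_inner_sq (v : HilbertBasis ℕ 𝕜 H) (x : H) :
    HasSum (fun k => ‖inner 𝕜 (v k) x‖ ^ 2) (‖x‖ ^ 2) := by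
  have h := lp.hasSum_norm (p := 2) (by norm_num) (v.repr x)
  simpa [v.repr_apply_apply] using h

lemma eq_of_inner_eq (v : HilbertBasis ℕ 𝕜 H) {x y : H}
    (h : ∀ k, inner 𝕜 (v k) x = inner 𝕜 (v k) y) : x = y := by
  apply v.repr.injective
  ext k
  simpa [v.repr_apply_apply] using h k

lemma spectralPow_spectralSum (v : HilbertBasis ℕ 𝕜 H) (lam : ℕ → ℝ) (σ : ℝ) {m : ℕ → ℝ} {g : H}
    (h : Summable fun k => m k ^ 2 * ‖inner 𝕜 (v k) g‖ ^ 2)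
    (hx : spectralSum v m g ∈ (spectralPow v lam σ).domain) :
    spectralPow v lam σ ⟨spectralSum v m g, hx⟩ =
      spectralSum v (fun k => lam k ^ σ * m k) g := by
  rw [spectralPow_apply]
  refine tsum_congr fun k => ?_
  rw [inner_spectralSum v h]
  push_cast
  rw [mul_assoc]

lemma spectralSum_mem_domain (v : HilbertBasis ℕ 𝕜 H) (lam : ℕ → ℝ) (σ : ℝ) {m : ℕ → ℝ} {g : H}
    (h : Summable fun k => m k ^ 2 * ‖inner 𝕜 (v k) g‖ ^ 2)
    (h' : Summable fun k => (lam k ^ σ * m k) ^ 2 * ‖inner 𝕜 (v k) g‖ ^ 2) :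
    spectralSum v m g ∈ (spectralPow v lam σ).domain := by
  refine mem_spectralPow_domain.2 (h'.congr fun k => ?_)
  rw [inner_spectralSum v h, norm_mul, RCLike.norm_ofReal, mul_pow, mul_pow, sq_abs]
  ring

/-- Uniformly bounded multipliers that are continuous coordinatewise give a continuous curve, by
Parseval's identity and dominated convergence. -/
lemma continuousOn_spectralSum (v : HilbertBasis ℕ 𝕜 H) {m : ℝ → ℕ → ℝ} {S : Set ℝ} {M : ℝ}
    (hc : ∀ k, ContinuousOn (fun t => m t k) S) (hM : ∀ t ∈ S, ∀ k, |m t k| ≤ M) (g : H) :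
    ContinuousOn (fun t => spectralSum v (m t) g) S := by
  intro t ht
  have hsum : ∀ s ∈ S, Summable fun k => m s k ^ 2 * ‖inner 𝕜 (v k) g‖ ^ 2 := fun s hs =>
    summable_weighted_of_abs_le v (hM s hs) g
  have hnorm : ∀ s ∈ S, ‖spectralSum v (m s) g - spectralSum v (m t) g‖ ^ 2 =
      ∑' k, (m s k - m t k) ^ 2 * ‖inner 𝕜 (v k) g‖ ^ 2 := by
    intro s hs
    rw [← (hasSum_norm_inner_sq v _).tsum_eq]
    refine tsum_congr fun k => ?_
    rw [inner_sub_right, inner_spectralSum v (hsum s hs), inner_spectralSum v (hsum t ht),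
      ← sub_mul, ← RCLike.ofReal_sub, norm_mul, RCLike.norm_ofReal, mul_pow, sq_abs]
  have hlim : Tendsto (fun s => ∑' k, (m s k - m t k) ^ 2 * ‖inner 𝕜 (v k) g‖ ^ 2)
      (𝓝[S] t) (𝓝 (∑' _ : ℕ, 0)) := by
    refine tendsto_tsum_of_dominated_convergence
      (bound := fun k => (2 * M) ^ 2 * ‖inner 𝕜 (v k) g‖ ^ 2)
      ((v.orthonormal.inner_products_summable g).mul_left _) (fun k => ?_) ?_
    · have h1 : Tendsto (fun s => (m s k - m t k) ^ 2 * ‖inner 𝕜 (v k) g‖ ^ 2) (𝓝[S] t)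
          (𝓝 ((m t k - m t k) ^ 2 * ‖inner 𝕜 (v k) g‖ ^ 2)) :=
        (((hc k t ht).tendsto.sub_const _).pow 2).mul_const _
      simpa using h1
    · filter_upwards [self_mem_nhdsWithin] with s hs k
      rw [Real.norm_of_nonneg (by positivity)]
      have h1 : (m s k - m t k) ^ 2 ≤ (2 * M) ^ 2 := by
        refine sq_le_sq.2 (le_trans ?_ (le_abs_self _))
        linarith [abs_sub (m s k) (m t k), hM s hs k, hM t ht k]
      gcongr
  rw [tsum_zero] at hlim
  rw [ContinuousWithinAt, tendsto_iff_norm_sub_tendsto_zero]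
  have h2 := (hlim.congr' (by
    filter_upwards [self_mem_nhdsWithin] with s hs using (hnorm s hs).symm)).sqrt
  simpa [Real.sqrt_sq (norm_nonneg _)] using h2

variable [NormedSpace ℝ H]

/-- The real-linear functional `x ↦ Re (y, x)`. With `y = z • v k` for all `k` and scalars `z`, these
functionals separate points and diagonalize every spectral multiplier with real coefficients. -/
def reInner (𝕜 : Type*) {H : Type*} [RCLike 𝕜] [NormedAddCommGroup H]
    [InnerProductSpace 𝕜 H] [NormedSpace ℝ H] (y : H) : H →L[ℝ] ℝ :=
  (RCLike.reCLM : 𝕜 →L[ℝ] ℝ) ∘L ((innerSL 𝕜 y).restrictScalars ℝ)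

lemma reInner_apply (y x : H) : reInner 𝕜 y x = RCLike.re (inner 𝕜 y x) := rfl

lemma eq_of_reInner_eq (v : HilbertBasis ℕ 𝕜 H) {x y : H}
    (h : ∀ (k : ℕ) (z : 𝕜), reInner 𝕜 (z • v k) x = reInner 𝕜 (z • v k) y) : x = y := by
  refine eq_of_inner_eq v fun k => ?_
  rw [← sub_eq_zero, ← inner_sub_right]
  have h1 := h k (inner 𝕜 (v k) (x - y))
  rw [← sub_eq_zero, ← map_sub, reInner_apply, inner_smul_left, RCLike.conj_mul] at h1
  have h2 : ‖inner 𝕜 (v k) (x - y)‖ ^ 2 = 0 := by exact_mod_cast h1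
  simpa using h2

lemma reInner_spectralSum (v : HilbertBasis ℕ 𝕜 H) {m : ℕ → ℝ} {g : H}
    (h : Summable fun k => m k ^ 2 * ‖inner 𝕜 (v k) g‖ ^ 2) (k : ℕ) (z : 𝕜) :
    reInner 𝕜 (z • v k) (spectralSum v m g) = m k * reInner 𝕜 (z • v k) g := by
  rw [reInner_apply, reInner_apply, inner_smul_left, inner_smul_left, inner_spectralSum v h,
    mul_left_comm, RCLike.re_ofReal_mul]

lemma spectralSum_const_mul (v : HilbertBasis ℕ 𝕜 H) (c : ℝ) (m : ℕ → ℝ) (g : H) :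
    spectralSum v (fun k => c * m k) g = c • spectralSum v m g := by
  rw [RCLike.real_smul_eq_coe_smul (K := 𝕜), spectralSum, spectralSum, ← tsum_const_smul'']
  refine tsum_congr fun k => ?_
  rw [smul_smul]
  push_cast
  rw [mul_assoc]

end Multiplier

/-! ### The Caputo integral of a vector-valued function -/

section CaputoIntegral

variable {H : Type*} [NormedAddCommGroup H] [NormedSpace ℝ H]

lemma intervalIntegrable_caputoKernel {ρ s : ℝ} (hρ : ρ ∈ Ioo (0 : ℝ) 1) (hs : 0 < s) {h : ℝ → H}
    (hc : ContinuousOn h (Icc 0 s)) : IntervalIntegrable (caputoKernel ρ h s) volume 0 s := by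
  refine (intervalIntegrable_const_sub_rpow (by linarith [hρ.2]) hs).smul_continuousOn ?_
  rw [uIcc_of_le hs.le]
  exact hc.sub continuousOn_const

lemma clm_caputoIntegral [CompleteSpace H] {ρ s : ℝ} (hρ : ρ ∈ Ioo (0 : ℝ) 1) (hs : 0 < s)
    {h : ℝ → H} (hc : ContinuousOn h (Icc 0 s)) (ℓ : H →L[ℝ] ℝ) :
    ℓ (caputoIntegral ρ h s) = ∫ ξ in (0 : ℝ)..s, (s - ξ) ^ (-ρ) * (ℓ (h ξ) - ℓ (h 0)) := by
  rw [caputoIntegral, ← ℓ.intervalIntegral_comp_comm (intervalIntegrable_caputoKernel hρ hs hc)]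
  simp [caputoKernel]

/-- The Caputo integral of a continuous function tends to zero at the origin. -/
lemma continuousWithinAt_caputoIntegral_zero {ρ T : ℝ} (hρ : ρ ∈ Ioo (0 : ℝ) 1) {h : ℝ → H}
    (hc : ContinuousOn h (Icc 0 T)) : ContinuousWithinAt (caputoIntegral ρ h) (Icc 0 T) 0 := by
  obtain ⟨K, hK⟩ := isCompact_Icc.exists_bound_of_continuousOn
    (hc.sub (continuousOn_const (c := h 0)))
  have h0 : caputoIntegral ρ h 0 = 0 := by simp [caputoIntegral]
  have hp : -1 < -ρ := by linarith [hρ.2]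
  have hbound : ∀ s ∈ Icc 0 T, ‖caputoIntegral ρ h s‖ ≤ s ^ (-ρ + 1) / (-ρ + 1) * K := by
    intro s hs
    rcases hs.1.eq_or_lt with rfl | hs0
    · simp [h0, Real.zero_rpow (show -ρ + 1 ≠ 0 by linarith)]
    rw [← integral_const_sub_rpow hp, ← intervalIntegral.integral_mul_const]
    refine intervalIntegral.norm_integral_le_of_norm_le hs.1 (Eventually.of_forall fun ξ hξ => ?_)
      ((intervalIntegrable_const_sub_rpow hp hs0).mul_const K)
    have h1 : 0 ≤ (s - ξ) ^ (-ρ) := Real.rpow_nonneg (by linarith [hξ.2]) _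
    rw [caputoKernel, norm_smul, Real.norm_of_nonneg h1]
    exact mul_le_mul_of_nonneg_left (hK ξ ⟨hξ.1.le, hξ.2.trans hs.2⟩) h1
  rw [ContinuousWithinAt, h0]
  refine squeeze_zero_norm' (eventually_mem_nhdsWithin.mono hbound) ?_
  have hcont : Continuous fun s : ℝ => s ^ (-ρ + 1) / (-ρ + 1) * K :=
    ((Real.continuous_rpow_const (by linarith)).div_const _).mul_const _
  have h2 := (hcont.tendsto 0).mono_left (nhdsWithin_le_nhds (s := Icc 0 T))
  simpa [Real.zero_rpow (show -ρ + 1 ≠ 0 by linarith)] using h2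

end CaputoIntegral

/-! ### Uniqueness -/

section Solution

variable {𝕜 H : Type*} [RCLike 𝕜] [NormedAddCommGroup H] [InnerProductSpace 𝕜 H]
  [NormedSpace ℝ H] [CompleteSpace H]

/-- Every coordinate of a solution satisfies the integrated relaxation equation. It follows from the
equation by integrating from `0`, where the Caputo integral is continuous and vanishes. -/
lemma IsForwardSolution.integral_reInner {v : HilbertBasis ℕ 𝕜 H} {lam : ℕ → ℝ} {σ ρ T : ℝ}
    {φ : H} {w : ℝ → H} (hρ : ρ ∈ Ioo (0 : ℝ) 1)
    (hw : IsForwardSolution (spectralPow v lam σ) ρ T φ w) (k : ℕ) (z : 𝕜) {s : ℝ}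
    (hs : s ∈ Ioc 0 T) :
    ∫ ξ in (0 : ℝ)..s, (s - ξ) ^ (-ρ) * (reInner 𝕜 (z • v k) (w ξ) - reInner 𝕜 (z • v k) φ) =
      -(Real.Gamma (1 - ρ) * lam k ^ σ) * ∫ ξ in (0 : ℝ)..s, reInner 𝕜 (z • v k) (w ξ) := by
  set ℓ := reInner 𝕜 (z • v k)
  have hΓ := Gamma_one_sub_pos hρ
  have hder : ∀ t ∈ Ioc 0 T, HasDerivWithinAt (fun s => ℓ (caputoIntegral ρ w s))
      (-(Real.Gamma (1 - ρ) * lam k ^ σ) * ℓ (w t)) (Icc 0 T) t := by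
    intro t ht
    have h1 := (hw.caputoDifferentiableOn t ht).2.hasDerivWithinAt
    have h2 : HasDerivWithinAt (fun s => ℓ (caputoIntegral ρ w s)) _ (Icc 0 T) t :=
      ℓ.hasFDerivAt.comp_hasDerivWithinAt t h1
    refine h2.congr_deriv ?_
    have h3 : derivWithin (caputoIntegral ρ w) (Icc 0 T) t =
        Real.Gamma (1 - ρ) • caputoDeriv ρ T w t := by
      rw [caputoDeriv, smul_smul, mul_one_div_cancel hΓ.ne', one_smul]
    have h4 : ℓ (spectralPow v lam σ ⟨w t, hw.mem_domain t ht⟩) = lam k ^ σ * ℓ (w t) := by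
      rw [spectralPow_apply]
      exact reInner_spectralSum v (hw.mem_domain t ht) k z
    rw [h3, eq_neg_of_add_eq_zero_left (hw.equation t ht), map_smul, map_neg, h4, smul_eq_mul]
    ring
  have hsub : Icc 0 s ⊆ Icc 0 T := Icc_subset_Icc_right hs.2
  have hcont : ContinuousOn (fun s => ℓ (caputoIntegral ρ w s)) (Icc 0 T) := by
    intro t ht
    rcases ht.1.eq_or_lt with rfl | h0
    · exact ℓ.continuous.continuousAt.comp_continuousWithinAt
        (continuousWithinAt_caputoIntegral_zero hρ hw.continuousOn)
    · exact (hder t ⟨h0, ht.2⟩).continuousWithinAt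
  have hℓw : ContinuousOn (fun t => ℓ (w t)) (Icc 0 s) :=
    ℓ.continuous.comp_continuousOn (hw.continuousOn.mono hsub)
  have key := intervalIntegral.integral_eq_sub_of_hasDerivAt_of_le hs.1.le (hcont.mono hsub)
    (fun t ht => (hder t ⟨ht.1, ht.2.le.trans hs.2⟩).hasDerivAt
      (Icc_mem_nhds ht.1 (ht.2.trans_le hs.2)))
    (((hℓw.intervalIntegrable_of_Icc hs.1.le).const_mul _))
  rw [intervalIntegral.integral_const_mul] at key
  rw [key, clm_caputoIntegral hρ hs.1 (hw.continuousOn.mono hsub), hw.initial]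
  simp [caputoIntegral]

theorem IsForwardSolution.eqOn {v : HilbertBasis ℕ 𝕜 H} {lam : ℕ → ℝ} {σ ρ T : ℝ} {φ : H}
    {w u : ℝ → H} (hρ : ρ ∈ Ioo (0 : ℝ) 1) (hT : 0 < T) (hlam : ∀ k, 0 ≤ lam k)
    (hw : IsForwardSolution (spectralPow v lam σ) ρ T φ w)
    (hu : IsForwardSolution (spectralPow v lam σ) ρ T φ u) : EqOn w u (Icc 0 T) := by
  intro t ht
  refine eq_of_reInner_eq v fun k z => ?_
  set ℓ := reInner 𝕜 (z • v k)
  have hcw : ContinuousOn (fun t => ℓ (w t)) (Icc 0 T) :=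
    ℓ.continuous.comp_continuousOn hw.continuousOn
  have hcu : ContinuousOn (fun t => ℓ (u t)) (Icc 0 T) :=
    ℓ.continuous.comp_continuousOn hu.continuousOn
  rw [← sub_eq_zero]
  refine eqOn_zero_of_integral_eq (κ := Real.Gamma (1 - ρ) * lam k ^ σ) hρ hT
    (mul_nonneg (Gamma_one_sub_pos hρ).le (Real.rpow_nonneg (hlam k) _)) (hcw.sub hcu)
    (fun s hs => ?_) t ht
  have hsub : Icc 0 s ⊆ Icc 0 T := Icc_subset_Icc_right hs.2
  have hint : ∀ f : ℝ → ℝ, ContinuousOn f (Icc 0 T) →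
      IntervalIntegrable (fun ξ => (s - ξ) ^ (-ρ) * (f ξ - ℓ φ)) volume 0 s := by
    intro f hf
    refine (intervalIntegrable_const_sub_rpow (by linarith [hρ.2]) hs.1).mul_continuousOn ?_
    rw [uIcc_of_le hs.1.le]
    exact (hf.mono hsub).sub continuousOn_const
  have e : ∀ ξ, (s - ξ) ^ (-ρ) * (ℓ (w ξ) - ℓ (u ξ)) =
      (s - ξ) ^ (-ρ) * (ℓ (w ξ) - ℓ φ) - (s - ξ) ^ (-ρ) * (ℓ (u ξ) - ℓ φ) := fun ξ => by ring
  change ∫ ξ in (0 : ℝ)..s, (s - ξ) ^ (-ρ) * (ℓ (w ξ) - ℓ (u ξ)) =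
    -(Real.Gamma (1 - ρ) * lam k ^ σ) * ∫ ξ in (0 : ℝ)..s, (ℓ (w ξ) - ℓ (u ξ))
  simp only [e]
  rw [intervalIntegral.integral_sub (hint _ hcw) (hint _ hcu), hw.integral_reInner hρ k z hs,
    hu.integral_reInner hρ k z hs,
    intervalIntegral.integral_sub ((hcw.mono hsub).intervalIntegrable_of_Icc hs.1.le)
      ((hcu.mono hsub).intervalIntegrable_of_Icc hs.1.le)]
  ring

end Solution

/-! ### The series solution -/

section Candidate

variable {𝕜 H : Type*} [RCLike 𝕜] [NormedAddCommGroup H] [InnerProductSpace 𝕜 H]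

/-- The series solution `∑ E_ρ(-λ_k^σ t^ρ) (φ, v_k) v_k`. -/
def forwardSolution (v : HilbertBasis ℕ 𝕜 H) (lam : ℕ → ℝ) (σ ρ : ℝ) (φ : H)
    (t : ℝ) : H :=
  spectralSum v (fun k => fracExp ρ (-(lam k ^ σ)) 0 t) φ

/-- The function `t ↦ t^ρ A^σ u(t)`, where `u` is the series solution. Unlike `A^σ u`, it is
bounded and continuous up to `t = 0`. -/
def weightedPowSolution (v : HilbertBasis ℕ 𝕜 H) (lam : ℕ → ℝ) (σ ρ : ℝ) (φ : H)
    (t : ℝ) : H :=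
  spectralSum v (fun k => lam k ^ σ * t ^ ρ * fracExp ρ (-(lam k ^ σ)) 0 t) φ

variable {v : HilbertBasis ℕ 𝕜 H} {lam : ℕ → ℝ} {σ ρ : ℝ} {φ : H}

lemma summable_forwardSolution (hρ : ρ ∈ Ioo (0 : ℝ) 1) (hlam : ∀ k, 0 ≤ lam k) {t : ℝ}
    (ht : 0 ≤ t) : Summable fun k =>
      fracExp ρ (-(lam k ^ σ)) 0 t ^ 2 * ‖inner 𝕜 (v k) φ‖ ^ 2 :=
  summable_weighted_of_abs_le v (fun k => abs_fracExp_le hρ (Real.rpow_nonneg (hlam k) σ) ht) φ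

lemma summable_weightedPowSolution (hρ : ρ ∈ Ioo (0 : ℝ) 1) (hlam : ∀ k, 0 ≤ lam k) {t : ℝ}
    (ht : 0 ≤ t) : Summable fun k =>
      (lam k ^ σ * t ^ ρ * fracExp ρ (-(lam k ^ σ)) 0 t) ^ 2 * ‖inner 𝕜 (v k) φ‖ ^ 2 :=
  summable_weighted_of_abs_le v
    (fun k => abs_mul_rpow_mul_fracExp_le hρ (Real.rpow_nonneg (hlam k) σ) ht) φ

lemma continuousOn_forwardSolution (hρ : ρ ∈ Ioo (0 : ℝ) 1) (hlam : ∀ k, 0 ≤ lam k) :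
    ContinuousOn (forwardSolution v lam σ ρ φ) (Ici 0) :=
  continuousOn_spectralSum v
    (fun k => (continuous_fracExp hρ.1 (-(lam k ^ σ)) le_rfl).continuousOn)
    (fun _ ht k => abs_fracExp_le hρ (Real.rpow_nonneg (hlam k) σ) ht) φ

lemma continuousOn_weightedPowSolution (hρ : ρ ∈ Ioo (0 : ℝ) 1) (hlam : ∀ k, 0 ≤ lam k) :
    ContinuousOn (weightedPowSolution v lam σ ρ φ) (Ici 0) :=
  continuousOn_spectralSum v
    (fun k => ((continuous_const.mul (Real.continuous_rpow_const hρ.1.le)).mul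
      (continuous_fracExp hρ.1 (-(lam k ^ σ)) le_rfl)).continuousOn)
    (fun _ ht k => abs_mul_rpow_mul_fracExp_le hρ (Real.rpow_nonneg (hlam k) σ) ht) φ

lemma forwardSolution_mem_domain (hρ : ρ ∈ Ioo (0 : ℝ) 1) (hlam : ∀ k, 0 ≤ lam k) {t : ℝ}
    (ht : 0 < t) : forwardSolution v lam σ ρ φ t ∈ (spectralPow v lam σ).domain := by
  refine spectralSum_mem_domain v lam σ (summable_forwardSolution hρ hlam ht.le) ?_
  refine ((summable_weightedPowSolution (v := v) (φ := φ) (σ := σ) hρ hlam ht.le).mul_left ((t ^ (-ρ)) ^ 2)).congr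
    fun k => ?_
  rw [← mul_assoc, ← mul_pow, rpow_neg_mul_rpow_mul ht]

lemma forwardSolution_zero (hρ : 0 < ρ) : forwardSolution v lam σ ρ φ 0 = φ := by
  rw [forwardSolution, spectralSum]
  simp only [fracExp_zero_apply_zero hρ, RCLike.ofReal_one, one_mul]
  have h := (v.hasSum_repr φ).tsum_eq
  simpa only [v.repr_apply_apply] using h

variable [NormedSpace ℝ H]

lemma spectralPow_forwardSolution (hρ : ρ ∈ Ioo (0 : ℝ) 1) (hlam : ∀ k, 0 ≤ lam k) {t : ℝ}
    (ht : 0 < t) (hx : forwardSolution v lam σ ρ φ t ∈ (spectralPow v lam σ).domain) :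
    spectralPow v lam σ ⟨forwardSolution v lam σ ρ φ t, hx⟩ =
      t ^ (-ρ) • weightedPowSolution v lam σ ρ φ t := by
  refine (spectralPow_spectralSum v lam σ (summable_forwardSolution hρ hlam ht.le) hx).trans ?_
  rw [weightedPowSolution, ← spectralSum_const_mul]
  simp only [rpow_neg_mul_rpow_mul ht]

lemma intervalIntegrable_rpow_smul_weightedPowSolution (hρ : ρ ∈ Ioo (0 : ℝ) 1)
    (hlam : ∀ k, 0 ≤ lam k) {s : ℝ} (hs : 0 ≤ s) :
    IntervalIntegrable (fun t => t ^ (-ρ) • weightedPowSolution v lam σ ρ φ t) volume 0 s := by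
  refine (intervalIntegral.intervalIntegrable_rpow' (by linarith [hρ.2])).smul_continuousOn ?_
  rw [uIcc_of_le hs]
  exact (continuousOn_weightedPowSolution hρ hlam).mono Icc_subset_Ici_self

variable [CompleteSpace H]

/-- The equation in integrated form; tested against `reInner 𝕜 (z • v k)`, it is the scalar identity
`integral_kernel_mul_sub_one`. -/
lemma caputoIntegral_forwardSolution (hρ : ρ ∈ Ioo (0 : ℝ) 1) (hlam : ∀ k, 0 ≤ lam k) {s : ℝ}
    (hs : 0 < s) : caputoIntegral ρ (forwardSolution v lam σ ρ φ) s =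
      -Real.Gamma (1 - ρ) • ∫ t in (0 : ℝ)..s, t ^ (-ρ) • weightedPowSolution v lam σ ρ φ t := by
  refine eq_of_reInner_eq v fun k z => ?_
  rw [clm_caputoIntegral hρ hs ((continuousOn_forwardSolution hρ hlam).mono Icc_subset_Ici_self),
    map_smul, ← ContinuousLinearMap.intervalIntegral_comp_comm _
      (intervalIntegrable_rpow_smul_weightedPowSolution hρ hlam hs.le), forwardSolution_zero hρ.1]
  set ℓ := reInner 𝕜 (z • v k)
  set c := -(lam k ^ σ) with hc
  have e1 : ∫ ξ in (0 : ℝ)..s, (s - ξ) ^ (-ρ) * (ℓ (forwardSolution v lam σ ρ φ ξ) - ℓ φ) =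
      ∫ ξ in (0 : ℝ)..s, (s - ξ) ^ (-ρ) * (fracExp ρ c 0 ξ - 1) * ℓ φ := by
    refine intervalIntegral.integral_congr fun ξ hξ => ?_
    rw [uIcc_of_le hs.le] at hξ
    have h1 : ℓ (forwardSolution v lam σ ρ φ ξ) = fracExp ρ c 0 ξ * ℓ φ :=
      reInner_spectralSum v (summable_forwardSolution hρ hlam hξ.1) k z
    simp only [h1]
    ring
  have e2 : ∫ t in (0 : ℝ)..s, ℓ (t ^ (-ρ) • weightedPowSolution v lam σ ρ φ t) =
      ∫ t in (0 : ℝ)..s, fracExp ρ c 0 t * (lam k ^ σ * ℓ φ) := by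
    -- On `Ioc 0 s`, as the junk value `0 ^ (-ρ)` breaks the identity at `t = 0`.
    rw [intervalIntegral.integral_of_le hs.le, intervalIntegral.integral_of_le hs.le]
    refine setIntegral_congr_fun measurableSet_Ioc fun t ht => ?_
    have h1 : ℓ (weightedPowSolution v lam σ ρ φ t) =
        lam k ^ σ * t ^ ρ * fracExp ρ c 0 t * ℓ φ :=
      reInner_spectralSum v (summable_weightedPowSolution hρ hlam ht.1.le) k z
    simp only [map_smul, h1, smul_eq_mul]
    rw [← mul_assoc, rpow_neg_mul_rpow_mul ht.1]
    ring
  rw [e1, e2, intervalIntegral.integral_mul_const, intervalIntegral.integral_mul_const,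
    integral_kernel_mul_sub_one hρ c hs, smul_eq_mul, hc]
  ring

lemma hasDerivAt_caputoIntegral_forwardSolution (hρ : ρ ∈ Ioo (0 : ℝ) 1) (hlam : ∀ k, 0 ≤ lam k)
    {t : ℝ} (ht : 0 < t) : HasDerivAt (caputoIntegral ρ (forwardSolution v lam σ ρ φ))
      (-Real.Gamma (1 - ρ) • t ^ (-ρ) • weightedPowSolution v lam σ ρ φ t) t := by
  have hcont : ContinuousOn (fun t => t ^ (-ρ) • weightedPowSolution v lam σ ρ φ t) (Ioi 0) := by
    refine ContinuousOn.smul (fun x hx => ?_)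
      ((continuousOn_weightedPowSolution hρ hlam).mono Ioi_subset_Ici_self)
    exact (Real.continuousAt_rpow_const _ _ (Or.inl (ne_of_gt hx))).continuousWithinAt
  have h := intervalIntegral.integral_hasDerivAt_right
    (intervalIntegrable_rpow_smul_weightedPowSolution hρ hlam ht.le)
    (hcont.stronglyMeasurableAtFilter isOpen_Ioi t ht) (hcont.continuousAt (Ioi_mem_nhds ht))
  refine (h.const_smul (-Real.Gamma (1 - ρ))).congr_of_eventuallyEq ?_
  filter_upwards [Ioi_mem_nhds ht] with s hs
  exact caputoIntegral_forwardSolution hρ hlam hs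

theorem isForwardSolution_forwardSolution (hρ : ρ ∈ Ioo (0 : ℝ) 1) (hlam : ∀ k, 0 ≤ lam k)
    {T : ℝ} (hT : 0 < T) :
    IsForwardSolution (spectralPow v lam σ) ρ T φ (forwardSolution v lam σ ρ φ) := by
  have hcaputo : ∀ t ∈ Ioc 0 T, caputoDeriv ρ T (forwardSolution v lam σ ρ φ) t =
      -(t ^ (-ρ) • weightedPowSolution v lam σ ρ φ t) := by
    intro t ht
    rw [caputoDeriv, (hasDerivAt_caputoIntegral_forwardSolution hρ hlam
      ht.1).hasDerivWithinAt.derivWithin (uniqueDiffOn_Icc hT t ⟨ht.1.le, ht.2⟩), neg_smul,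
      smul_neg, smul_smul, one_div_mul_cancel (Gamma_one_sub_pos hρ).ne', one_smul]
  have hcont : ContinuousOn (fun t => t ^ (-ρ) • weightedPowSolution v lam σ ρ φ t) (Ioc 0 T) := by
    refine ContinuousOn.smul (fun x hx => ?_)
      ((continuousOn_weightedPowSolution hρ hlam).mono fun x hx => hx.1.le)
    exact (Real.continuousAt_rpow_const _ _ (Or.inl hx.1.ne')).continuousWithinAt
  have hu : ContinuousOn (forwardSolution v lam σ ρ φ) (Icc 0 T) :=
    (continuousOn_forwardSolution hρ hlam).mono Icc_subset_Ici_self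
  refine ⟨hu, fun t ht => ⟨?_, ?_⟩, hcont.neg.congr hcaputo,
    fun t ht => forwardSolution_mem_domain hρ hlam ht.1, ?_, fun t ht => ?_,
    forwardSolution_zero hρ.1⟩
  · exact intervalIntegrable_caputoKernel hρ ht.1 (hu.mono (Icc_subset_Icc_right ht.2))
  · exact (hasDerivAt_caputoIntegral_forwardSolution hρ
      hlam ht.1).differentiableAt.differentiableWithinAt
  · refine (continuousOn_iff_continuous_domRestrict.1 hcont).congr fun t => ?_
    exact (spectralPow_forwardSolution hρ hlam t.2.1 _).symm
  · rw [hcaputo t ht, spectralPow_forwardSolution hρ hlam ht.1, neg_add_cancel]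

end Candidate

end

theorem theorem1 {𝕜 H : Type*} [RCLike 𝕜] [NormedAddCommGroup H] [InnerProductSpace 𝕜 H]
    [NormedSpace ℝ H] [CompleteSpace H] [TopologicalSpace.SeparableSpace H]
    (A : H →ₗ.[𝕜] H) (hA : IsSelfAdjoint A)
    (C : ℝ) (hC : 0 < C)
    (hpos : ∀ h : A.domain, C * ‖(h : H)‖ ^ 2 ≤ RCLike.re (inner 𝕜 (A h) (h : H)))
    (v : HilbertBasis ℕ 𝕜 H) (lam : ℕ → ℝ)
    (hv : ∀ k, ∃ hk : v k ∈ A.domain, A ⟨v k, hk⟩ = (lam k : 𝕜) • v k)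
    (hlam_pos : 0 < lam 0) (hlam_mono : Monotone lam)
    (hlam_lim : Filter.Tendsto lam Filter.atTop Filter.atTop)
    (ρ σ T : ℝ) (hρ : ρ ∈ Set.Ioo (0 : ℝ) 1) (hσ : 0 < σ) (hT : 0 < T) (φ : H) :
    ∃ u : ℝ → H,
      IsForwardSolution (spectralPow v lam σ) ρ T φ u ∧
      (∀ w : ℝ → H, IsForwardSolution (spectralPow v lam σ) ρ T φ w →
        Set.EqOn w u (Set.Icc 0 T)) ∧
      ∀ t ∈ Set.Icc (0 : ℝ) T,
        HasSum
          (fun k => (inner 𝕜 (v k) φ * (mittagLeffler ρ (-(lam k ^ σ) * t ^ ρ) : 𝕜)) • v k)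
          (u t) := by
  have hlam : ∀ k, 0 ≤ lam k := fun k => hlam_pos.le.trans (hlam_mono (Nat.zero_le k))
  have hu := isForwardSolution_forwardSolution (v := v) (σ := σ) (φ := φ) hρ hlam hT
  refine ⟨forwardSolution v lam σ ρ φ, hu, fun w hw => hw.eqOn hρ hT hlam hu, fun t ht => ?_⟩
  refine (hasSum_spectralSum v (summable_forwardSolution hρ hlam ht.1)).congr_fun fun k => ?_
  rw [fracExp_zero, mul_comm]
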